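/- Theorem (Halting problem for lasso programs). \label{thm-halting} Let $\mathbb{K}$ be the ordered field $\mathbb{Q}$ or any real closed field (for example $\mathbb{R}$). A linear lasso program $P=(n,\mathrm{stem},\mathrm{loop})$ consists of a number $n\ge 0$ of program variables, a quantifier-free formula $\mathrm{stem}(x_1,\dots,x_n)$ and a quantifier-free formula $\mathrm{loop}(x_1,\dots,x_n,x_1',\dots,x_n')$ of linear arithmetic; that is, both are built with $\neg,\wedge,\vee,\rightarrow$ from atoms $s\le t$ and $s=t$, where $s,t$ are terms built from the variables and the constants $0,1$ with the binary operations $+$ and $-$. The program terminates over $\mathbb{K}$ iff there is no infinite sequence $\sigma_0,\sigma_1,\sigma_2,\dots$ in $\mathbb{K}^n$ such that $\mathrm{stem}(\sigma_0)$ holds in $\mathbb{K}$ and $\mathrm{loop}(\sigma_i,\sigma_{i+1})$ holds in $\mathbb{K}$ for all $i\ge 0$. Termination of linear lasso programs is undecidable: for every such $\mathbb{K}$ there is no algorithm which, given (a standard Gödel number of) an arbitrary linear lasso program $P$, decides whether $P$ terminates over $\mathbb{K}$. -/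

import Mathlib

namespace Lasso

/-- A lasso program over the domain `S`: a set of initial states (the stem) and a binary
transition relation (the loop). -/
structure LassoProgram (S : Type*) where
  stem : Set S
  loop : S → S → Prop

/-- An infinite execution: it starts in the stem and every step is a loop transition. -/
def LassoProgram.IsInfiniteExecution {S : Type*} (P : LassoProgram S) (σ : ℕ → S) : Prop :=
  σ 0 ∈ P.stem ∧ ∀ i, P.loop (σ i) (σ (i + 1))

/-- A lasso program terminates iff it has no execution of infinite length. -/
def LassoProgram.Terminates {S : Type*} (P : LassoProgram S) : Prop :=
  ¬ ∃ σ : ℕ → S, P.IsInfiniteExecution σ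

/-- Terms over the function symbols `0`, `1`, `+`, `-` of linear arithmetic, with variables
in `V`. -/
inductive LinTerm (V : Type) : Type where
  | var (v : V)
  | zero
  | one
  | add (s t : LinTerm V)
  | sub (s t : LinTerm V)

/-- Quantifier-free formulas of linear arithmetic: the relation symbols are `≤` and `=`. -/
inductive LinFormula (V : Type) : Type where
  | le (s t : LinTerm V)
  | eq (s t : LinTerm V)
  | neg (φ : LinFormula V)
  | conj (φ ψ : LinFormula V)
  | disj (φ ψ : LinFormula V)
  | imp (φ ψ : LinFormula V)

section Semantics

variable {V : Type} {K : Type*} [Field K] [LinearOrder K]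

/-- The value of a term under the valuation `x`. -/
def LinTerm.eval (x : V → K) : LinTerm V → K
  | .var v => x v
  | .zero => 0
  | .one => 1
  | .add s t => s.eval x + t.eval x
  | .sub s t => s.eval x - t.eval x

/-- Truth of a formula under the valuation `x`. -/
def LinFormula.Holds (x : V → K) : LinFormula V → Prop
  | .le s t => s.eval x ≤ t.eval x
  | .eq s t => s.eval x = t.eval x
  | .neg φ => ¬ φ.Holds x
  | .conj φ ψ => φ.Holds x ∧ ψ.Holds x
  | .disj φ ψ => φ.Holds x ∨ ψ.Holds x
  | .imp φ ψ => φ.Holds x → ψ.Holds x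

end Semantics

/-- A linear lasso program, as a finite object: the number `n` of program variables, a stem
formula in the variables `x₁, …, xₙ`, and a loop formula in `x₁, …, xₙ` (left summand) and the
primed variables `x₁', …, xₙ'` (right summand). -/
structure LinearLasso : Type where
  n : ℕ
  stem : LinFormula (Fin n)
  loop : LinFormula (Fin n ⊕ Fin n)

/-- The lasso program over the domain `Kⁿ` that the formulas of `P` define. -/
def LinearLasso.toLassoProgram (K : Type*) [Field K] [LinearOrder K] (P : LinearLasso) :
    LassoProgram (Fin P.n → K) where
  stem := {x | P.stem.Holds x}
  loop := fun x x' => P.loop.Holds (Sum.elim x x')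

/-! Gödel numbering of linear lasso programs. -/

/-- The Gödel number of a term, given one for each variable. -/
def LinTerm.code {V : Type} (c : V → ℕ) : LinTerm V → ℕ
  | .var v => Nat.pair 0 (c v)
  | .zero => Nat.pair 1 0
  | .one => Nat.pair 2 0
  | .add s t => Nat.pair 3 (Nat.pair (s.code c) (t.code c))
  | .sub s t => Nat.pair 4 (Nat.pair (s.code c) (t.code c))

/-- The Gödel number of a formula, given one for each variable. -/
def LinFormula.code {V : Type} (c : V → ℕ) : LinFormula V → ℕ
  | .le s t => Nat.pair 0 (Nat.pair (s.code c) (t.code c))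
  | .eq s t => Nat.pair 1 (Nat.pair (s.code c) (t.code c))
  | .neg φ => Nat.pair 2 (φ.code c)
  | .conj φ ψ => Nat.pair 3 (Nat.pair (φ.code c) (ψ.code c))
  | .disj φ ψ => Nat.pair 4 (Nat.pair (φ.code c) (ψ.code c))
  | .imp φ ψ => Nat.pair 5 (Nat.pair (φ.code c) (ψ.code c))

/-- The Gödel number of a linear lasso program. In the loop formula the `i`-th unprimed variable
is numbered `2 * i` and the `i`-th primed variable is numbered `2 * i + 1`. -/
def LinearLasso.code (P : LinearLasso) : ℕ :=
  Nat.pair P.n (Nat.pair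
    (P.stem.code fun i : Fin P.n => (i : ℕ))
    (P.loop.code (Sum.elim (fun i : Fin P.n => 2 * (i : ℕ)) fun i : Fin P.n => 2 * (i : ℕ) + 1)))

theorem LinTerm.code_injective {V : Type} {c : V → ℕ} (hc : Function.Injective c) :
    Function.Injective (LinTerm.code c) := by
  intro s
  induction s with
  | var v => intro t h; cases t <;> simp_all [LinTerm.code, Nat.pair_eq_pair, hc.eq_iff]
  | zero => intro t h; cases t <;> simp_all [LinTerm.code, Nat.pair_eq_pair]
  | one => intro t h; cases t <;> simp_all [LinTerm.code, Nat.pair_eq_pair]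
  | add a b iha ihb =>
    intro t h
    cases t <;> simp only [LinTerm.code, Nat.pair_eq_pair] at h <;> try omega
    rw [iha h.2.1, ihb h.2.2]
  | sub a b iha ihb =>
    intro t h
    cases t <;> simp only [LinTerm.code, Nat.pair_eq_pair] at h <;> try omega
    rw [iha h.2.1, ihb h.2.2]

theorem LinFormula.code_injective {V : Type} {c : V → ℕ} (hc : Function.Injective c) :
    Function.Injective (LinFormula.code c) := by
  intro φ
  induction φ with
  | le a b =>
    intro t h
    cases t <;> simp only [LinFormula.code, Nat.pair_eq_pair] at h <;> try omega
    rw [LinTerm.code_injective hc h.2.1, LinTerm.code_injective hc h.2.2]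
  | eq a b =>
    intro t h
    cases t <;> simp only [LinFormula.code, Nat.pair_eq_pair] at h <;> try omega
    rw [LinTerm.code_injective hc h.2.1, LinTerm.code_injective hc h.2.2]
  | neg a iha =>
    intro t h
    cases t <;> simp only [LinFormula.code, Nat.pair_eq_pair] at h <;> try omega
    rw [iha h.2]
  | conj a b iha ihb | disj a b iha ihb | imp a b iha ihb =>
    intro t h
    cases t <;> simp only [LinFormula.code, Nat.pair_eq_pair] at h <;> try omega
    rw [iha h.2.1, ihb h.2.2]

/-- Different programs have different Gödel numbers. -/
theorem LinearLasso.code_injective : Function.Injective LinearLasso.code := by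
  rintro ⟨n, s, l⟩ ⟨m, s', l'⟩ h
  simp only [LinearLasso.code, Nat.pair_eq_pair] at h
  obtain ⟨rfl, hs, hl⟩ := h
  have h1 := LinFormula.code_injective Fin.val_injective hs
  have h2 : l = l' := by
    refine LinFormula.code_injective ?_ hl
    rintro (i | i) (j | j) hij <;> simp only [Sum.elim_inl, Sum.elim_inr] at hij
    · exact congrArg Sum.inl (Fin.ext (by omega))
    · omega
    · omega
    · exact congrArg Sum.inr (Fin.ext (by omega))
  rw [h1, h2]

end Lasso

/-! The halting problem reduces to nontermination. Fix one machine, the four-stack machine of a code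
`c` that on input `2 ^ k` runs the partial recursive function numbered `k` on `0`. A stack over four
symbols is a base-five fraction with nonzero digits, so pushing, popping and testing the top are
affine operations and comparisons with rational coefficients. With label and local store as two more
numbers, a configuration is a point of `K ^ 6` and one machine step is a quantifier-free linear
relation (`stmtRel_iff`, `linDefinable_stmtRel`). On encoded configurations this relation is the
graph of the step function and is empty at a halt, so an infinite run exists iff the machine does
not halt (`exists_run_iff`).

The loop is thus one fixed formula, and the input enters only through the stem. The stack for `2 ^
k` is `k` equal symbols followed by two fixed ones, so the stem comes from iterating one operation
on terms, and its Gödel number is primitive recursive in `k`. -/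

namespace Lasso

open Turing Turing.PartrecToTM2

/-! ### Definability by quantifier-free linear formulas -/

section Definability

variable {V : Type}

/-- The `n`-fold sum of a term. -/
def LinTerm.nsmul (t : LinTerm V) : ℕ → LinTerm V
  | 0 => .zero
  | n + 1 => .add (t.nsmul n) t

variable {K : Type*} [Field K]

@[simp]
theorem LinTerm.eval_nsmul (x : V → K) (t : LinTerm V) (n : ℕ) :
    (t.nsmul n).eval x = n * t.eval x := by
  induction n with
  | zero => simp [LinTerm.nsmul, LinTerm.eval]
  | succ n ih => simp only [LinTerm.nsmul, LinTerm.eval, ih]; push_cast; ring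

/-- Affine functions with rational coefficients: some positive multiple is a term. -/
def RatAffine (f : (V → K) → K) : Prop :=
  ∃ n : ℕ, 0 < n ∧ ∃ t : LinTerm V, ∀ x, n * f x = t.eval x

theorem RatAffine.var (v : V) : RatAffine fun x : V → K => x v :=
  ⟨1, one_pos, .var v, fun x => by simp [LinTerm.eval]⟩

theorem RatAffine.natCast (n : ℕ) : RatAffine fun _ : V → K => (n : K) :=
  ⟨1, one_pos, LinTerm.nsmul .one n, fun x => by simp [LinTerm.eval]⟩

theorem RatAffine.add {f g : (V → K) → K} (hf : RatAffine f) (hg : RatAffine g) :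
    RatAffine fun x => f x + g x := by
  obtain ⟨n, hn, s, hs⟩ := hf
  obtain ⟨m, hm, t, ht⟩ := hg
  refine ⟨n * m, Nat.mul_pos hn hm, .add (s.nsmul m) (t.nsmul n), fun x => ?_⟩
  simp only [LinTerm.eval, LinTerm.eval_nsmul, ← hs, ← ht]
  push_cast
  ring

theorem RatAffine.sub {f g : (V → K) → K} (hf : RatAffine f) (hg : RatAffine g) :
    RatAffine fun x => f x - g x := by
  obtain ⟨n, hn, s, hs⟩ := hf
  obtain ⟨m, hm, t, ht⟩ := hg
  refine ⟨n * m, Nat.mul_pos hn hm, .sub (s.nsmul m) (t.nsmul n), fun x => ?_⟩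
  simp only [LinTerm.eval, LinTerm.eval_nsmul, ← hs, ← ht]
  push_cast
  ring

theorem RatAffine.natCast_mul {f : (V → K) → K} (hf : RatAffine f) (k : ℕ) :
    RatAffine fun x => (k : K) * f x := by
  obtain ⟨n, hn, s, hs⟩ := hf
  refine ⟨n, hn, s.nsmul k, fun x => ?_⟩
  simp only [LinTerm.eval_nsmul, ← hs]
  ring

variable [LinearOrder K]

/-- Predicates defined by a quantifier-free linear formula. -/
def LinDefinable (p : (V → K) → Prop) : Prop :=
  ∃ φ : LinFormula V, ∀ x, φ.Holds x ↔ p x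

theorem LinDefinable.const (p : Prop) : LinDefinable fun _ : V → K => p := by
  by_cases hp : p
  · exact ⟨.eq .zero .zero, fun x => by simp [LinFormula.Holds, hp]⟩
  · exact ⟨.neg (.eq .zero .zero), fun x => by simp [LinFormula.Holds, hp]⟩

theorem LinDefinable.not {p : (V → K) → Prop} (hp : LinDefinable p) :
    LinDefinable fun x => ¬ p x := by
  obtain ⟨φ, h⟩ := hp
  exact ⟨.neg φ, fun x => by simp [LinFormula.Holds, h]⟩

theorem LinDefinable.and {p q : (V → K) → Prop} (hp : LinDefinable p) (hq : LinDefinable q) :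
    LinDefinable fun x => p x ∧ q x := by
  obtain ⟨φ, h⟩ := hp
  obtain ⟨ψ, h'⟩ := hq
  exact ⟨.conj φ ψ, fun x => by simp [LinFormula.Holds, h, h']⟩

theorem LinDefinable.or {p q : (V → K) → Prop} (hp : LinDefinable p) (hq : LinDefinable q) :
    LinDefinable fun x => p x ∨ q x := by
  obtain ⟨φ, h⟩ := hp
  obtain ⟨ψ, h'⟩ := hq
  exact ⟨.disj φ ψ, fun x => by simp [LinFormula.Holds, h, h']⟩

theorem LinDefinable.exists_mem {ι : Type*} {p : ι → (V → K) → Prop} (s : Finset ι)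
    (hp : ∀ i, LinDefinable (p i)) : LinDefinable fun x => ∃ i ∈ s, p i x := by
  classical
  induction s using Finset.induction_on with
  | empty => simpa using LinDefinable.const False
  | insert a s _ ih => simpa using (hp a).or ih

theorem LinDefinable.exists {ι : Type*} [Fintype ι] {p : ι → (V → K) → Prop}
    (hp : ∀ i, LinDefinable (p i)) : LinDefinable fun x => ∃ i, p i x := by
  simpa using LinDefinable.exists_mem Finset.univ hp

theorem LinDefinable.forall {ι : Type*} [Fintype ι] {p : ι → (V → K) → Prop}
    (hp : ∀ i, LinDefinable (p i)) : LinDefinable fun x => ∀ i, p i x := by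
  simpa using (LinDefinable.exists fun i => (hp i).not).not

variable [IsStrictOrderedRing K]

theorem RatAffine.div_natCast {f : (V → K) → K} (hf : RatAffine f) {k : ℕ} (hk : 0 < k) :
    RatAffine fun x => f x / (k : K) := by
  obtain ⟨n, hn, s, hs⟩ := hf
  refine ⟨n * k, Nat.mul_pos hn hk, s, fun x => ?_⟩
  rw [← hs]
  have : (k : K) ≠ 0 := by exact_mod_cast hk.ne'
  push_cast
  field_simp

theorem RatAffine.le {f g : (V → K) → K} (hf : RatAffine f) (hg : RatAffine g) :
    LinDefinable fun x => f x ≤ g x := by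
  obtain ⟨n, hn, t, ht⟩ := hg.sub hf
  refine ⟨.le .zero t, fun x => ?_⟩
  have hn' : (0 : K) < n := by exact_mod_cast hn
  rw [LinFormula.Holds, ← ht, LinTerm.eval, mul_nonneg_iff_of_pos_left hn', sub_nonneg]

theorem RatAffine.lt {f g : (V → K) → K} (hf : RatAffine f) (hg : RatAffine g) :
    LinDefinable fun x => f x < g x := by
  simpa using (hg.le hf).not

theorem RatAffine.eq {f g : (V → K) → K} (hf : RatAffine f) (hg : RatAffine g) :
    LinDefinable fun x => f x = g x := by
  simpa [le_antisymm_iff] using (hf.le hg).and (hg.le hf)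

end Definability

/-! ### Stacks as fractions in base five -/

/-- The nonzero base-five digit that represents a stack symbol. -/
def digit : Γ' → ℕ
  | .consₗ => 1
  | .cons => 2
  | .bit0 => 3
  | .bit1 => 4

theorem digit_pos (a : Γ') : 0 < digit a := by cases a <;> decide

theorem digit_le (a : Γ') : digit a ≤ 4 := by cases a <;> decide

theorem digit_injective : Function.Injective digit := by
  intro a b
  cases a <;> cases b <;> simp [digit]

/-- The number that represents an optional symbol. -/
def optDigit : Option Γ' → ℕ
  | none => 0
  | some a => digit a

theorem optDigit_injective : Function.Injective optDigit := by
  rintro (_ | a) (_ | b) h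
  · rfl
  · exact absurd h (digit_pos b).ne
  · exact absurd h (digit_pos a).ne'
  · exact congrArg some (digit_injective h)

/-! ### Machine statements as linear relations -/

section Simulation

variable {K : Type*} [Field K]

/-- The fraction with base-five expansion given by a stack, top symbol first. -/
def stackValue (K : Type*) [Field K] : List Γ' → K
  | [] => 0
  | a :: l => (digit a + stackValue K l) / 5

/-- The value of a stack after removing its top symbol. -/
def popValue (y : K) : Option Γ' → K
  | none => y
  | some a => 5 * y - digit a

/-- The program state with label number `q`, local store `v` and stack values `s`. -/
def encodeState (q : ℕ) (v : Option Γ') (s : K' → K) : Fin 6 → K :=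
  ![q, optDigit v, s .main, s .rev, s .aux, s .stack]

/-- The position of a stack among the program variables. -/
def stackIndex : K' → Fin 6
  | .main => 2
  | .rev => 3
  | .aux => 4
  | .stack => 5

theorem encodeState_stackIndex (q : ℕ) (v : Option Γ') (s : K' → K) (k : K') :
    encodeState q v s (stackIndex k) = s k := by
  cases k <;> rfl

theorem update_stackValue (S : K' → List Γ') (k : K') (l : List Γ') :
    Function.update (fun k => stackValue K (S k)) k (stackValue K l) =
      fun j => stackValue K (Function.update S k l j) := by
  funext j
  rcases eq_or_ne j k with rfl | h <;> simp [*]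

theorem ratAffine_popValue {V : Type} {f : (V → K) → K} (hf : RatAffine f) (o : Option Γ') :
    RatAffine fun x => popValue (f x) o := by
  rcases o with _ | a
  · exact hf
  · have h5 : RatAffine fun x => (5 : K) * f x := by simpa using hf.natCast_mul 5
    exact h5.sub (.natCast _)

theorem ratAffine_update {V : Type} {s : (V → K) → K' → K} (hs : ∀ k, RatAffine fun x => s x k)
    {f : (V → K) → K} (hf : RatAffine f) (k j : K') :
    RatAffine fun x => Function.update (s x) k (f x) j := by
  rcases eq_or_ne j k with rfl | h
  · simpa using hf
  · simpa [h] using hs j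

variable [LinearOrder K]

/-- The number `y` represents a stack with top symbol `o` (`none` for the empty stack). -/
def TopIs (y : K) : Option Γ' → Prop
  | none => y = 0
  | some a => digit a ≤ 5 * y ∧ 5 * y < digit a + 1

/-- The transition relation of a statement, on stacks given by their values. -/
def StmtRel (e : Λ' → ℕ) : TM2.Stmt (fun _ : K' => Γ') Λ' (Option Γ') → Option Γ' →
    (K' → K) → (Fin 6 → K) → Prop
  | .push k f q, v, s, y =>
    StmtRel e q v (Function.update s k ((digit (f v) + s k) / 5)) y
  | .peek k f q, v, s, y => ∃ o, TopIs (s k) o ∧ StmtRel e q (f v o) s y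
  | .pop k f q, v, s, y =>
    ∃ o, TopIs (s k) o ∧ StmtRel e q (f v o) (Function.update s k (popValue (s k) o)) y
  | .load a q, v, s, y => StmtRel e q (a v) s y
  | .branch f q₁ q₂, v, s, y => cond (f v) (StmtRel e q₁ v s y) (StmtRel e q₂ v s y)
  | .goto l, v, s, y => y = encodeState (e (l v)) v s
  -- A halting statement has no successor, so the simulating run gets stuck.
  | .halt, _, _, _ => False

variable [IsStrictOrderedRing K]

theorem stackValue_mem_Ico (l : List Γ') : 0 ≤ stackValue K l ∧ stackValue K l < 1 := by
  induction l with
  | nil => simp [stackValue]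
  | cons a l ih =>
    have h : (digit a : K) ≤ 4 := by exact_mod_cast digit_le a
    have h0 : (0 : K) ≤ digit a := by positivity
    simp only [stackValue]
    constructor
    · have := ih.1
      positivity
    · rw [div_lt_one (by norm_num)]
      linarith [ih.2]

theorem five_mul_stackValue_cons (a : Γ') (l : List Γ') :
    5 * stackValue K (a :: l) = digit a + stackValue K l := by
  simp only [stackValue]
  field_simp

/-- The tail has value in `[0, 1)`, so the top digit is the integer part of `5 * y`; since digits
are positive, only the empty stack has value `0`. -/
theorem topIs_stackValue_iff (l : List Γ') (o : Option Γ') :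
    TopIs (stackValue K l) o ↔ o = l.head? := by
  rcases l with _ | ⟨a, l⟩ <;> rcases o with _ | b
  · simp [TopIs, stackValue]
  · have := digit_pos b
    simp [TopIs, stackValue, this.ne']
  · have h := five_mul_stackValue_cons (K := K) a l
    have h1 : (0 : K) < digit a := by exact_mod_cast digit_pos a
    have h2 := (stackValue_mem_Ico (K := K) l).1
    simp only [TopIs, List.head?_cons, reduceCtorEq, iff_false]
    intro h0
    rw [h0] at h
    linarith
  · obtain ⟨h0, h1⟩ := stackValue_mem_Ico (K := K) l
    simp only [TopIs, List.head?_cons, Option.some.injEq, five_mul_stackValue_cons]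
    constructor
    · rintro ⟨h2, h3⟩
      have h4 : (digit b : K) < (digit a + 1 : ℕ) := by push_cast; linarith
      have h5 : (digit a : K) < (digit b + 1 : ℕ) := by push_cast; linarith
      rw [Nat.cast_lt] at h4 h5
      exact digit_injective (by omega)
    · rintro rfl
      constructor <;> linarith

theorem popValue_stackValue (l : List Γ') :
    popValue (stackValue K l) l.head? = stackValue K l.tail := by
  cases l with
  | nil => rfl
  | cons a l => simp [popValue, five_mul_stackValue_cons]

/-- On genuine stack values the guessed top symbol in `peek` and `pop` is forced, so the relation is
deterministic and follows `TM2.stepAux`. -/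
theorem stmtRel_iff (e : Λ' → ℕ) (q : TM2.Stmt (fun _ : K' => Γ') Λ' (Option Γ'))
    (v : Option Γ') (S : K' → List Γ') (y : Fin 6 → K) :
    StmtRel e q v (fun k => stackValue K (S k)) y ↔
      ∃ l, (TM2.stepAux q v S).l = some l ∧
        y = encodeState (e l) (TM2.stepAux q v S).var
          fun k => stackValue K ((TM2.stepAux q v S).stk k) := by
  induction q generalizing v S with
  | push k f q ih =>
    rw [StmtRel, TM2.stepAux, ← ih, ← update_stackValue]
    rfl
  | peek k f q ih => simp [StmtRel, TM2.stepAux, topIs_stackValue_iff, ih]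
  | pop k f q ih =>
    simp only [StmtRel, TM2.stepAux, topIs_stackValue_iff, exists_eq_left, popValue_stackValue,
      update_stackValue, ih]
  | load a q ih => simp only [StmtRel, TM2.stepAux, ih]
  | branch f q₁ q₂ ih₁ ih₂ =>
    simp only [StmtRel, TM2.stepAux]
    cases f v
    · exact ih₂ v S
    · exact ih₁ v S
  | goto l => simp [StmtRel, TM2.stepAux]
  | halt => simp [StmtRel, TM2.stepAux]

theorem linDefinable_topIs {V : Type} {f : (V → K) → K} (hf : RatAffine f) (o : Option Γ') :
    LinDefinable fun x => TopIs (f x) o := by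
  rcases o with _ | a
  · simpa [TopIs] using hf.eq (.natCast 0)
  · have h5 : RatAffine fun x => (5 : K) * f x := by simpa using hf.natCast_mul 5
    have h1 : RatAffine fun _ : V → K => (digit a : K) + 1 := by
      simpa using RatAffine.natCast (V := V) (K := K) (digit a + 1)
    exact ((RatAffine.natCast _).le h5).and (h5.lt h1)

theorem linDefinable_eq_encodeState {V : Type} (q : ℕ) (v : Option Γ') {s : (V → K) → K' → K}
    (hs : ∀ k, RatAffine fun x => s x k) {y : (V → K) → Fin 6 → K}
    (hy : ∀ i, RatAffine fun x => y x i) :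
    LinDefinable fun x => y x = encodeState q v (s x) := by
  simp only [funext_iff]
  refine LinDefinable.forall fun i => (hy i).eq ?_
  fin_cases i
  exacts [.natCast q, .natCast (optDigit v), hs .main, hs .rev, hs .aux, hs .stack]

/-- The store `v` is a parameter, not a variable, so branches are resolved while the formula is
built; guessing a top symbol is a finite disjunction. -/
theorem linDefinable_stmtRel {V : Type} (e : Λ' → ℕ)
    (q : TM2.Stmt (fun _ : K' => Γ') Λ' (Option Γ')) (v : Option Γ') {s : (V → K) → K' → K}
    (hs : ∀ k, RatAffine fun x => s x k) {y : (V → K) → Fin 6 → K}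
    (hy : ∀ i, RatAffine fun x => y x i) :
    LinDefinable fun x => StmtRel e q v (s x) (y x) := by
  induction q generalizing v s with
  | push k f q ih =>
    refine ih v fun j => ratAffine_update hs ?_ k j
    simpa using ((RatAffine.natCast _).add (hs k)).div_natCast (k := 5) (by norm_num)
  | peek k f q ih =>
    exact LinDefinable.exists fun o => (linDefinable_topIs (hs k) o).and (ih _ hs)
  | pop k f q ih =>
    exact LinDefinable.exists fun o => (linDefinable_topIs (hs k) o).and
      (ih _ fun j => ratAffine_update hs (ratAffine_popValue (hs k) o) k j)
  | load a q ih => exact ih _ hs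
  | branch f q₁ q₂ ih₁ ih₂ =>
    simp only [StmtRel]
    cases f v
    · exact ih₂ v hs
    · exact ih₁ v hs
  | goto l => exact linDefinable_eq_encodeState _ _ hs hy
  | halt => exact LinDefinable.const False

/-! ### The loop -/

/-- The program state of a machine configuration with label `l`. -/
def encodeCfg (K : Type*) [Field K] (e : Λ' → ℕ) (l : Λ') (v : Option Γ') (S : K' → List Γ') :
    Fin 6 → K :=
  encodeState (e l) v fun k => stackValue K (S k)

/-- One step of the machine, restricted to the labels in `L`. -/
def LoopRel (e : Λ' → ℕ) (L : Finset Λ') (x y : Fin 6 → K) : Prop :=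
  ∃ q ∈ L, ∃ v, x 0 = (e q : ℕ) ∧ x 1 = (optDigit v : ℕ) ∧
    StmtRel e (tr q) v (fun k => x (stackIndex k)) y

/-- Injectivity of the label numbering on `L` and of `optDigit` leaves a single disjunct that can
fire. -/
theorem loopRel_encodeCfg_iff {e : Λ' → ℕ} {L : Finset Λ'} (he : Set.InjOn e L) {l : Λ'}
    (hl : l ∈ L) (v : Option Γ') (S : K' → List Γ') (y : Fin 6 → K) :
    LoopRel e L (encodeCfg K e l v S) y ↔
      ∃ l', (TM2.stepAux (tr l) v S).l = some l' ∧
        y = encodeCfg K e l' (TM2.stepAux (tr l) v S).var (TM2.stepAux (tr l) v S).stk := by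
  have key := stmtRel_iff (K := K) e (tr l) v S y
  simp only [LoopRel, encodeCfg, encodeState_stackIndex]
  rw [← key]
  constructor
  · rintro ⟨q, hq, w, h0, h1, h⟩
    have h0' : e l = e q := by simpa [encodeState] using h0
    have h1' : optDigit v = optDigit w := by simpa [encodeState] using h1
    obtain rfl := he hl hq h0'
    obtain rfl := optDigit_injective h1'
    exact h
  · exact fun h => ⟨l, hl, v, rfl, rfl, h⟩

theorem linDefinable_loopRel (e : Λ' → ℕ) (L : Finset Λ') :
    ∃ φ : LinFormula (Fin 6 ⊕ Fin 6), ∀ x y : Fin 6 → K,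
      φ.Holds (Sum.elim x y) ↔ LoopRel e L x y := by
  obtain ⟨φ, h⟩ : LinDefinable fun z : Fin 6 ⊕ Fin 6 → K =>
      LoopRel e L (fun i => z (.inl i)) fun i => z (.inr i) :=
    LinDefinable.exists_mem L fun q => LinDefinable.exists fun v =>
      ((RatAffine.var _).eq (.natCast _)).and <| ((RatAffine.var _).eq (.natCast _)).and <|
        linDefinable_stmtRel e (tr q) v (fun _ => .var _) fun _ => .var _
  exact ⟨φ, fun x y => h _⟩

theorem supportsStmt_stepAux {L : Finset Λ'} {q : TM2.Stmt (fun _ : K' => Γ') Λ' (Option Γ')}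
    (hq : TM2.SupportsStmt L q) (v : Option Γ') (S : K' → List Γ') {l : Λ'}
    (hl : (TM2.stepAux q v S).l = some l) : l ∈ L := by
  induction q generalizing v S with
  | push k f q ih => exact ih hq _ _ hl
  | peek k f q ih => exact ih hq _ _ hl
  | pop k f q ih => exact ih hq _ _ hl
  | load a q ih => exact ih hq _ _ hl
  | branch f q₁ q₂ ih₁ ih₂ =>
    simp only [TM2.stepAux] at hl
    cases hf : f v
    · exact ih₂ hq.2 v S (by simpa [hf] using hl)
    · exact ih₁ hq.1 v S (by simpa [hf] using hl)
  | goto f =>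
    simp only [TM2.stepAux, Option.some.injEq] at hl
    exact hl ▸ hq v
  | halt => simp [TM2.stepAux] at hl

/-- A run of the loop from the code of a configuration exists iff the machine does not halt. -/
theorem exists_run_iff {e : Λ' → ℕ} {L : Finset Λ'} (he : Set.InjOn e L)
    (hL : ∀ q ∈ L, TM2.SupportsStmt L (tr q)) {l : Λ'} (hl : l ∈ L) (v : Option Γ')
    (S : K' → List Γ') :
    (∃ σ : ℕ → Fin 6 → K, σ 0 = encodeCfg K e l v S ∧ ∀ i, LoopRel e L (σ i) (σ (i + 1))) ↔
      ¬ (StateTransition.eval (TM2.step tr) ⟨some l, v, S⟩).Dom := by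
  constructor
  · rintro ⟨σ, h0, hσ⟩ hdom
    obtain ⟨c, hc⟩ := Part.dom_iff_mem.1 hdom
    obtain ⟨hr, hn⟩ := StateTransition.mem_eval.1 hc
    have key : ∃ i, ∃ l' ∈ L, c.l = some l' ∧ σ i = encodeCfg K e l' c.var c.stk := by
      clear hn hc
      induction hr with
      | refl => exact ⟨0, l, hl, rfl, h0⟩
      | @tail b c _ hbc ih =>
        obtain ⟨i, l', hl', hbl, hi⟩ := ih
        obtain ⟨bl, bv, bS⟩ := b
        obtain rfl : bl = some l' := hbl
        have hstep := hσ i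
        rw [hi, loopRel_encodeCfg_iff he hl'] at hstep
        obtain ⟨l'', h1, h2⟩ := hstep
        obtain rfl : TM2.stepAux (tr l') bv bS = c := Option.some.inj hbc
        exact ⟨i + 1, l'', supportsStmt_stepAux (hL _ hl') _ _ h1, h1, h2⟩
    obtain ⟨-, l', -, hcl, -⟩ := key
    obtain ⟨cl, cv, cS⟩ := c
    obtain rfl : cl = some l' := hcl
    exact Option.some_ne_none _ hn
  · intro hdom
    -- The default `c` only makes `next` total: by `live`, a reached configuration always has a
    -- label, as otherwise the machine would have halted.
    let next : TM2.Cfg (fun _ : K' => Γ') Λ' (Option Γ') →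
      TM2.Cfg (fun _ : K' => Γ') Λ' (Option Γ') := fun c => (TM2.step tr c).getD c
    let run : ℕ → TM2.Cfg (fun _ : K' => Γ') Λ' (Option Γ') := fun i => next^[i] ⟨some l, v, S⟩
    have hrun : ∀ i, run (i + 1) = next (run i) := fun i => Function.iterate_succ_apply' _ _ _
    have live : ∀ i, StateTransition.Reaches (TM2.step tr) ⟨some l, v, S⟩ (run i) →
        ∃ l', (run i).l = some l' := by
      intro i hi
      by_contra! hne
      refine hdom (Part.dom_iff_mem.2 ⟨run i, StateTransition.mem_eval.2 ⟨hi, ?_⟩⟩)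
      rcases hr : run i with ⟨_ | l', w, T⟩
      · rfl
      · exact absurd (by rw [hr]) (hne l')
    have inv : ∀ i, StateTransition.Reaches (TM2.step tr) ⟨some l, v, S⟩ (run i) ∧
        ∃ l' ∈ L, (run i).l = some l' := by
      intro i
      induction i with
      | zero => exact ⟨.refl, l, hl, rfl⟩
      | succ i ih =>
        obtain ⟨hreach, l', hl', hi⟩ := ih
        have hstep : TM2.step tr (run i) = some (run (i + 1)) := by
          rw [hrun]
          rcases hr : run i with ⟨_ | l', w, T⟩
          · simp [hr] at hi
          · rfl
        have hreach' := hreach.tail hstep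
        refine ⟨hreach', ?_⟩
        obtain ⟨l'', h''⟩ := live _ hreach'
        refine ⟨l'', ?_, h''⟩
        rcases hr : run i with ⟨_ | m, w, T⟩
        · simp [hr] at hi
        · obtain rfl : m = l' := by simpa [hr] using hi
          rw [hr] at hstep
          rw [← Option.some.inj hstep] at h''
          exact supportsStmt_stepAux (hL _ hl') _ _ h''
    choose hreach lab hlab hrunl using inv
    refine ⟨fun i => encodeCfg K e (lab i) (run i).var (run i).stk, ?_, fun i => ?_⟩
    · obtain rfl : l = lab 0 := Option.some.inj (hrunl 0)
      rfl
    · rw [loopRel_encodeCfg_iff he (hlab i)]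
      have hnext : run (i + 1) = TM2.stepAux (tr (lab i)) (run i).var (run i).stk := by
        rw [hrun]
        have := hrunl i
        rcases hr : run i with ⟨_ | m, w, T⟩
        · simp [hr] at this
        · obtain rfl : m = lab i := by simpa [hr] using this
          rfl
      rw [← hnext]
      exact ⟨lab (i + 1), hrunl (i + 1), rfl⟩

/-- The computations of a recursive function are simulated by a single linear loop. -/
theorem exists_linear_loop (K : Type*) [Field K] [LinearOrder K] [IsStrictOrderedRing K]
    (c : ToPartrec.Code) :
    ∃ (φ : LinFormula (Fin 6 ⊕ Fin 6)) (q₀ : ℕ), ∀ v : List ℕ,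
      (∃ σ : ℕ → Fin 6 → K,
        σ 0 = encodeState q₀ none (fun k => stackValue K (K'.elim (trList v) [] [] [] k)) ∧
          ∀ i, φ.Holds (Sum.elim (σ i) (σ (i + 1)))) ↔ ¬ (c.eval v).Dom := by
  -- The machine for `c` stays within this finite set of labels, which are numbered by their
  -- position in a list.
  set L := codeSupp c .halt
  let e : Λ' → ℕ := fun q => L.toList.idxOf q
  have he : Set.InjOn e L := fun a ha b _ h =>
    (List.idxOf_inj (Finset.mem_toList.2 ha)).1 h
  obtain ⟨φ, hφ⟩ := linDefinable_loopRel (K := K) e L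
  refine ⟨φ, e (trNormal c .halt), fun v => ?_⟩
  have h := exists_run_iff (K := K) he (tr_supports c .halt).2
    (codeSupp_self c .halt (trStmts₁_self _)) none (K'.elim (trList v) [] [] [])
  have heval := tr_eval c v
  unfold init at heval
  simp only [hφ]
  refine h.trans (not_congr ?_)
  have := congrArg Part.Dom heval
  simpa using this

end Simulation

/-! ### The stem -/

/-- The term for the value of a stack after removing the symbol `a` from its top. -/
def popTerm {V : Type} (a : Γ') (t : LinTerm V) : LinTerm V :=
  .sub (t.nsmul 5) (LinTerm.nsmul .one (digit a))

/-- A term that vanishes iff the stack with value `t` holds the input `2 ^ k`. -/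
def inputTerm {V : Type} (t : LinTerm V) (k : ℕ) : LinTerm V :=
  popTerm .cons (popTerm .bit1 ((popTerm .bit0)^[k] t))

/-- Binary digits are listed least significant first. -/
theorem trNat_two_pow (k : ℕ) : trNat (2 ^ k) = List.replicate k .bit0 ++ [.bit1] := by
  have h : ((2 ^ k : ℕ) : Num) = Num.pos (PosNum.bit0^[k] 1) := by
    induction k with
    | zero => rfl
    | succ k ih =>
      rw [pow_succ, mul_two, Nat.cast_add, ih, Function.iterate_succ_apply']
      exact congrArg Num.pos (PosNum.bit0_of_bit0 _)
  rw [trNat, h, trNum]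
  clear h
  induction k with
  | zero => rfl
  | succ k ih => rw [Function.iterate_succ_apply', trPosNum, ih]; rfl

theorem trList_two_pow (k : ℕ) :
    trList [2 ^ k] = List.replicate k .bit0 ++ [.bit1, .cons] := by
  simp [trList, trNat_two_pow]

section Stem

variable {K : Type*} [Field K] [LinearOrder K] [IsStrictOrderedRing K]

theorem eval_popTerm {V : Type} (x : V → K) (a : Γ') (t : LinTerm V) (l : List Γ') :
    (popTerm a t).eval x = stackValue K l ↔ t.eval x = stackValue K (a :: l) := by
  simp only [popTerm, LinTerm.eval, LinTerm.eval_nsmul, stackValue]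
  rw [eq_div_iff (by norm_num)]
  push_cast
  constructor <;> intro h <;> linarith

/-- Undoing the pushes of the whole input must leave the empty stack, of value `0`. Each undoing
multiplies by five, so no division is needed. -/
theorem eval_inputTerm {V : Type} (x : V → K) (t : LinTerm V) (k : ℕ) :
    (inputTerm t k).eval x = 0 ↔ t.eval x = stackValue K (trList [2 ^ k]) := by
  have hpop : ∀ (k : ℕ) (l : List Γ'), ((popTerm .bit0)^[k] t).eval x = stackValue K l ↔
      t.eval x = stackValue K (List.replicate k .bit0 ++ l) := by
    intro k
    induction k with
    | zero => intro l; rfl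
    | succ k ih =>
      intro l
      rw [Function.iterate_succ_apply', eval_popTerm, ih, List.replicate_succ', List.append_assoc]
      rfl
  rw [trList_two_pow, ← hpop, ← eval_popTerm, ← eval_popTerm]
  rfl

end Stem

theorem code_nsmul {V : Type} (c : V → ℕ) (t : LinTerm V) (n : ℕ) :
    (t.nsmul n).code c = (fun m => Nat.pair 3 (Nat.pair m (t.code c)))^[n] (Nat.pair 1 0) := by
  induction n with
  | zero => rfl
  | succ n ih => rw [Function.iterate_succ_apply', ← ih]; rfl

/-- Popping acts on Gödel numbers alone, so iterated popping becomes primitive recursion on codes.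
-/
theorem primrec_popTerm (a : Γ') : ∃ g : ℕ → ℕ, Primrec g ∧
    ∀ {V : Type} (c : V → ℕ) (t : LinTerm V), (popTerm a t).code c = g (t.code c) := by
  refine ⟨fun m => Nat.pair 4 (Nat.pair
    ((fun n => Nat.pair 3 (Nat.pair n m))^[5] (Nat.pair 1 0))
    ((fun n => Nat.pair 3 (Nat.pair n (Nat.pair 2 0)))^[digit a] (Nat.pair 1 0))), ?_, ?_⟩
  · refine Primrec₂.natPair.comp (.const _) (Primrec₂.natPair.comp ?_ (.const _))
    refine Primrec.nat_iterate (.const 5) (.const _) ?_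
    exact Primrec₂.natPair.comp (.const _) (Primrec₂.natPair.comp .snd .fst)
  · intro V c t
    simp only [popTerm, LinTerm.code, code_nsmul]

theorem primrec_code_inputTerm {V : Type} (c : V → ℕ) (t : LinTerm V) :
    Primrec fun k => (inputTerm t k).code c := by
  obtain ⟨g₀, hg₀, h₀⟩ := primrec_popTerm .bit0
  obtain ⟨g₁, hg₁, h₁⟩ := primrec_popTerm .bit1
  obtain ⟨g₂, hg₂, h₂⟩ := primrec_popTerm .cons
  have hiter : ∀ k, ((popTerm .bit0)^[k] t).code c = g₀^[k] (t.code c) := by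
    intro k
    induction k with
    | zero => rfl
    | succ k ih => rw [Function.iterate_succ_apply', Function.iterate_succ_apply', h₀, ih]
  simp only [inputTerm, h₁, h₂, hiter]
  exact hg₂.comp (hg₁.comp (Primrec.nat_iterate .id (.const _) (hg₀.comp .snd)))

/-! ### Undecidability -/

/-- An unbounded search recovers the exponent from the input, and the universal function then runs
the code it numbers. -/
theorem exists_code_halting : ∃ c : ToPartrec.Code, ∀ d : Nat.Partrec.Code,
    (c.eval [2 ^ Encodable.encode d]).Dom ↔ (d.eval 0).Dom := by
  let search (n : ℕ) : ℕ →. Bool := fun m => Part.some (decide (2 ^ m = n))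
  let f : ℕ →. ℕ := fun n => (Nat.rfind (search n)).bind fun k =>
    (Denumerable.ofNat Nat.Partrec.Code k).eval 0
  have hf : Partrec f := by
    refine Partrec.bind (Partrec.rfind ?_) ?_
    · have hpow : Primrec fun m : ℕ => 2 ^ m :=
        (Primrec.nat_iterate (f := id) (g := fun _ => 1) (h := fun _ b => 2 * b) .id (.const 1)
          (Primrec.nat_mul.comp (.const 2) .snd)).of_eq fun m => by simp
      exact (Primrec.eq.comp (hpow.comp .snd) .fst).decide.to_comp.partrec
    · exact Nat.Partrec.Code.eval_part.comp ((Computable.ofNat _).comp .snd) (.const 0)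
  obtain ⟨c, hc⟩ := ToPartrec.Code.exists_code (Nat.Partrec'.part_iff₁.2 hf)
  refine ⟨c, fun d => ?_⟩
  have h := hc (⟨[2 ^ Encodable.encode d], rfl⟩)
  have hr : Nat.rfind (search (2 ^ Encodable.encode d)) = Part.some (Encodable.encode d) := by
    rw [Part.eq_some_iff, Nat.mem_rfind]
    exact ⟨by simp [search], fun {m} hm => by simp [search, hm.ne]⟩
  have hfd : f (2 ^ Encodable.encode d) = d.eval 0 := by
    simp only [f]
    rw [hr]
    simp
  rw [show c.eval [2 ^ Encodable.encode d] = _ from h]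
  change (pure <$> f (2 ^ Encodable.encode d)).Dom ↔ _
  rw [hfd]
  rfl

/-- Halting of codes reduces to termination of linear lasso programs over `K`. -/
theorem exists_halting_reduction (K : Type*) [Field K] [LinearOrder K] [IsStrictOrderedRing K] :
    ∃ P : Nat.Partrec.Code → LinearLasso, (Computable fun d => (P d).code) ∧
      ∀ d, ((P d).toLassoProgram K).Terminates ↔ (d.eval 0).Dom := by
  obtain ⟨c, hc⟩ := exists_code_halting
  obtain ⟨φ, q₀, hφ⟩ := exists_linear_loop K c
  -- `ψ` fixes every coordinate except the main stack, coordinate `2`, which is left free;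
  -- `inputTerm` pins that one down.
  obtain ⟨ψ, hψ⟩ : LinDefinable fun x : Fin 6 → K =>
      x = encodeState q₀ none (fun k => if k = .main then x 2 else 0) := by
    refine linDefinable_eq_encodeState q₀ none (fun k => ?_) fun _ => .var _
    by_cases hk : k = .main
    · simpa [hk] using RatAffine.var _
    · simpa [hk] using RatAffine.natCast 0
  let P : ℕ → LinearLasso := fun k =>
    ⟨6, .conj ψ (.eq (inputTerm (.var 2) k) .zero), φ⟩
  have hP : ∀ k, ((P k).toLassoProgram K).Terminates ↔ (c.eval [2 ^ k]).Dom := by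
    intro k
    rw [← not_iff_not, ← hφ, LassoProgram.Terminates, not_not]
    refine exists_congr fun σ => and_congr ?_ Iff.rfl
    change (ψ.Holds (σ 0) ∧ (inputTerm (.var 2) k).eval (σ 0) = 0) ↔ _
    rw [hψ, eval_inputTerm, LinTerm.eval]
    constructor
    · rintro ⟨h1, h2⟩
      rw [h1, h2]
      congr 1
      funext j
      cases j <;> rfl
    · intro h
      have h2 : σ 0 2 = stackValue K (trList [2 ^ k]) := by rw [h]; rfl
      refine ⟨?_, h2⟩
      beta_reduce
      rw [h2, h]
      congr 1
      funext j
      cases j <;> rfl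
  -- This is `(P k).code` unfolded: tag `3` is the conjunction, tag `1` the equation, and the inner
  -- `Nat.pair 1 0` the term zero.
  have hcode : Primrec fun k => Nat.pair 6 (Nat.pair
      (Nat.pair 3 (Nat.pair (ψ.code fun i : Fin 6 => (i : ℕ)) (Nat.pair 1 (Nat.pair
        ((inputTerm (.var (2 : Fin 6)) k).code fun i : Fin 6 => (i : ℕ)) (Nat.pair 1 0)))))
      (φ.code (Sum.elim (fun i : Fin 6 => 2 * (i : ℕ)) fun i : Fin 6 => 2 * (i : ℕ) + 1))) :=
    Primrec₂.natPair.comp (.const 6) <| Primrec₂.natPair.comp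
      (Primrec₂.natPair.comp (.const 3) <| Primrec₂.natPair.comp (.const _) <|
        Primrec₂.natPair.comp (.const 1) <|
          Primrec₂.natPair.comp (primrec_code_inputTerm _ _) (.const _))
      (.const _)
  exact ⟨fun d => P (Encodable.encode d), hcode.to_comp.comp .encode,
    fun d => (hP _).trans (hc d)⟩

end Lasso

theorem mainTheorem4 (K : Type*) [Field K] [LinearOrder K] [IsStrictOrderedRing K]
    (hK : Nonempty (K ≃+*o ℚ) ∨ IsRealClosed K) :
    ¬ ∃ decide : ℕ → Bool, Computable decide ∧
      ∀ P : Lasso.LinearLasso,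
        decide P.code = true ↔ (P.toLassoProgram K).Terminates := by
  rintro ⟨dec, hdec, hterm⟩
  obtain ⟨P, hP, hhalt⟩ := Lasso.exists_halting_reduction K
  refine ComputablePred.halting_problem 0 (ComputablePred.computable_iff.2
    ⟨fun d => dec (P d).code, hdec.comp hP, funext fun d => propext ?_⟩)
  rw [hterm, hhalt]
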